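/- Let $r_{\mathrm{odd}}(n,C_n)$ denote the least number of colours $r$ for which there is an edge-colouring of the complete graph $K_n$ with $r$ colours such that every Hamilton cycle of $K_n$ has an odd number of edges in some colour class. For every even integer $n\ge 4$, $$\left(\frac{\sqrt2}{2}+o(1)\right)\sqrt n\;\le\; r_{\mathrm{odd}}(n,C_n)\;\le\;\frac{3\sqrt2}{2}\sqrt n ,$$ where the $o(1)$ error term tends to $0$ as $n$ tends to infinity. In particular, $r_{\mathrm{odd}}(n,C_n)=\Theta(\sqrt n)$ as $n\to\infty$ through even integers. -/

import Mathlib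

open Filter Topology Asymptotics

/-- `IsOddColouring H c`: under the edge-colouring `c` of `G`, every copy of `H` in `G`
(a subgraph of `G` isomorphic to `H`) has an odd number of edges in some colour class. -/
def IsOddColouring {V W K : Type*} {G : SimpleGraph V} (H : SimpleGraph W)
    (c : G.edgeSet → K) : Prop :=
  ∀ H' : G.Subgraph, Nonempty (H ≃g H'.coe) →
    ∃ i : K, Odd {e : G.edgeSet | (e : Sym2 V) ∈ H'.edgeSet ∧ c e = i}.ncard

/-- The odd-Ramsey number of `H` in `G`: the least number `r` of colours in an edge-colouring
of `G` such that every copy of `H` in `G` has an odd colour class. -/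
noncomputable def oddRamseyNumber {V W : Type*} (G : SimpleGraph V) (H : SimpleGraph W) : ℕ :=
  sInf {r : ℕ | ∃ c : G.edgeSet → Fin r, IsOddColouring H c}

/-- The infimum above is over a nonempty set, hence a minimum, as soon as the host graph is finite
and `H` has an edge: give all edges distinct colours. -/
theorem oddRamseyNumber_spec {V W : Type*} [Finite V] (G : SimpleGraph V) (H : SimpleGraph W)
    (hH : ∃ x y, H.Adj x y) :
    IsLeast {r : ℕ | ∃ c : G.edgeSet → Fin r, IsOddColouring H c} (oddRamseyNumber G H) := by
  have hne : {r : ℕ | ∃ c : G.edgeSet → Fin r, IsOddColouring H c}.Nonempty := by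
    refine ⟨Nat.card G.edgeSet, Finite.equivFin G.edgeSet, ?_⟩
    rintro H' ⟨f⟩
    obtain ⟨x, y, hxy⟩ := hH
    have hadj : H'.Adj (f x) (f y) := f.map_rel_iff.2 hxy
    let e : G.edgeSet := ⟨s((f x : V), (f y : V)), hadj.adj_sub⟩
    refine ⟨Finite.equivFin G.edgeSet e, ?_⟩
    have hs : {e' : G.edgeSet | (e' : Sym2 V) ∈ H'.edgeSet ∧
        Finite.equivFin G.edgeSet e' = Finite.equivFin G.edgeSet e} = {e} := by
      ext e'
      simp only [Set.mem_ofPred_eq, EmbeddingLike.apply_eq_iff_eq, Set.mem_singleton_iff]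
      constructor
      · exact fun h => h.2
      · rintro rfl
        exact ⟨hadj, rfl⟩
    rw [hs, Set.ncard_singleton]
    exact odd_one
  exact ⟨Nat.sInf_mem hne, fun r hr => Nat.sInf_le hr⟩

/-- The odd-Ramsey number of the Hamilton cycle: host graph the complete graph on `n` vertices,
target graph the cycle with `n` vertices (`SimpleGraph.cycleGraph n` is this cycle for `n ≥ 3`). -/
noncomputable def oddRamseyHamilton (n : ℕ) : ℕ :=
  oddRamseyNumber (⊤ : SimpleGraph (Fin n)) (SimpleGraph.cycleGraph n)

/-! Lower bound. Give an edge of colour `k` the basis vector `e k` of `X = 𝔽₂^r`; a Hamilton cycle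
with all colour classes even is one of total weight zero. Reversing the middle of a path `a i j b`
changes its weight by that of a four-cycle. Vertex-disjoint gadgets with independent changes
spanning `L` can therefore correct any error in `L`, and it suffices to find a Hamilton cycle
through them whose weight lies in `L`. If all four-cycles in a set have weight in `L`, then modulo
`L` the edge weights there have the form `f x + f y + κ`, which sums to zero around an even cycle.
An exchange argument on maximal gadget families (`exists_core`) yields a large such set that stays
flat when the vertices of any one gadget are added. Each remaining vertex either joins the flat set
with a suitable potential or creates a new independent gadget (`IsTemplate.exists_full`). Rank
bounds the second case by `r` occurrences, so `2r² + O(r)` vertices suffice.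
`IsTemplate.exists_even_cycle` builds and corrects the cycle. Upper bound. Put all vertices but one,
`s`, into a grid with `q = 2 ^ d` columns labelled by `𝔽₂^d`. Colour an edge off `s` by the sum of
its column labels and an edge at `s` by the row of its other end. If all classes were even, summing
labels would put the two neighbours of `s` in one column, hence in different rows, and a row colour
would occur exactly once. -/

/-! ### From copies of the cycle to cyclic orderings of the vertices. -/

/-- The pair-function of an edge-colouring of a complete graph, with a default on the diagonal. -/
noncomputable def pairColour {V K : Type*} [Inhabited K]
    (c : (⊤ : SimpleGraph V).edgeSet → K) (x y : V) : K :=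
  open Classical in if h : x ≠ y then c ⟨s(x, y), by simpa using h⟩ else default

theorem pairColour_comm {V K : Type*} [Inhabited K]
    (c : (⊤ : SimpleGraph V).edgeSet → K) (x y : V) : pairColour c x y = pairColour c y x := by
  unfold pairColour
  by_cases h : x = y
  · subst h; rfl
  · rw [dif_pos h, dif_pos (Ne.symm h)]
    congr 2
    exact Sym2.eq_swap

theorem pairColour_of_ne {V K : Type*} [Inhabited K]
    (c : (⊤ : SimpleGraph V).edgeSet → K) {x y : V} (h : x ≠ y)
    (h' : s(x, y) ∈ (⊤ : SimpleGraph V).edgeSet) : pairColour c x y = c ⟨s(x, y), h'⟩ := by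
  rw [pairColour, dif_pos h]

theorem cycleGraph_adj_succ {m : ℕ} (i : Fin (m + 3)) :
    (SimpleGraph.cycleGraph (m + 3)).Adj i (i + 1) := by
  rw [SimpleGraph.cycleGraph_adj]
  right; abel

theorem fin_ne_succ {m : ℕ} (i : Fin (m + 3)) : i ≠ i + 1 :=
  (cycleGraph_adj_succ i).ne

theorem fin_two_ne_zero {m : ℕ} : (1 + 1 : Fin (m + 3)) ≠ 0 := by
  intro h
  have := congrArg Fin.val h
  simp only [Fin.val_add, Fin.val_one, Fin.val_zero] at this
  rw [Nat.mod_eq_of_lt (by omega)] at this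
  omega

/-- The colour counts of a copy of a cycle, read along the cycle. -/
theorem ncard_colour_class {V K : Type*} [Inhabited K] [DecidableEq K] {m : ℕ}
    (c : (⊤ : SimpleGraph V).edgeSet → K) (H' : (⊤ : SimpleGraph V).Subgraph)
    (φ : SimpleGraph.cycleGraph (m + 3) ≃g H'.coe) (k : K) :
    {e : (⊤ : SimpleGraph V).edgeSet | (e : Sym2 V) ∈ H'.edgeSet ∧ c e = k}.ncard =
      (Finset.univ.filter fun i : Fin (m + 3) =>
        pairColour c (φ i : V) (φ (i + 1) : V) = k).card := by
  have hinj : Function.Injective fun i => (φ i : V) :=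
    Subtype.val_injective.comp φ.injective
  have hne : ∀ i, (φ i : V) ≠ (φ (i + 1) : V) := fun i h => fin_ne_succ i (hinj h)
  let E : Fin (m + 3) → (⊤ : SimpleGraph V).edgeSet := fun i =>
    ⟨s((φ i : V), (φ (i + 1) : V)), by simpa using hne i⟩
  -- Two positions could also share an edge traversed in opposite directions; this would force `2 =
  -- 0` in `Fin (m + 3)`.
  have hEinj : Function.Injective E := by
    intro i j hij
    have h := congrArg Subtype.val hij
    simp only [E, Sym2.eq_iff] at h
    rcases h with ⟨h, -⟩ | ⟨h1, h2⟩
    · exact hinj h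
    · have h1 : i = j + 1 := hinj h1
      have h2 : i + 1 = j := hinj h2
      exfalso
      rw [h1, add_assoc] at h2
      exact fin_two_ne_zero (by simpa using h2)
  have hset : {e : (⊤ : SimpleGraph V).edgeSet | (e : Sym2 V) ∈ H'.edgeSet ∧ c e = k} =
      E '' {i | pairColour c (φ i : V) (φ (i + 1) : V) = k} := by
    ext ⟨e, he⟩
    constructor
    · rintro ⟨h1, h2⟩
      induction e using Sym2.ind with
      | _ x y =>
        have hadj : H'.Adj x y := h1
        obtain ⟨i, hi⟩ := φ.surjective ⟨x, hadj.fst_mem⟩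
        obtain ⟨j, hj⟩ := φ.surjective ⟨y, hadj.snd_mem⟩
        have hx : (φ i : V) = x := by rw [hi]
        have hy : (φ j : V) = y := by rw [hj]
        subst hx hy
        have hij : (SimpleGraph.cycleGraph (m + 3)).Adj i j := φ.map_rel_iff.1 hadj
        rw [SimpleGraph.cycleGraph_adj] at hij
        rcases hij with h | h
        · have : i = j + 1 := by rw [← h]; abel
          subst this
          refine ⟨j, ?_, Subtype.ext Sym2.eq_swap⟩
          change pairColour c _ _ = k
          rw [pairColour_comm, pairColour_of_ne c (hne j).symm he]
          exact h2
        · have : j = i + 1 := by rw [← h]; abel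
          subst this
          refine ⟨i, ?_, rfl⟩
          change pairColour c _ _ = k
          rw [pairColour_of_ne c (hne i) he]
          exact h2
    · rintro ⟨i, hi, hie⟩
      rw [← hie]
      refine ⟨φ.map_rel_iff.2 (cycleGraph_adj_succ i), ?_⟩
      rw [← hi, pairColour_of_ne c (hne i)]
  rw [hset, Set.ncard_image_of_injective _ hEinj, ← Set.ncard_coe_finset]
  congr 1
  ext i
  simp

theorem isOddColouring_cycleGraph_iff {K : Type*} [Inhabited K] [DecidableEq K] {m : ℕ}
    (c : (⊤ : SimpleGraph (Fin (m + 3))).edgeSet → K) :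
    IsOddColouring (SimpleGraph.cycleGraph (m + 3)) c ↔
      ∀ v : Equiv.Perm (Fin (m + 3)), ∃ k : K,
        Odd (Finset.univ.filter fun i => pairColour c (v i) (v (i + 1)) = k).card := by
  constructor
  · intro hc v
    let H' : (⊤ : SimpleGraph (Fin (m + 3))).Subgraph :=
      { verts := Set.univ
        Adj := fun x y => (SimpleGraph.cycleGraph (m + 3)).Adj (v.symm x) (v.symm y)
        adj_sub := fun {x y} h => by
          rw [SimpleGraph.top_adj]
          rintro rfl
          exact h.ne rfl
        edge_vert := fun _ => Set.mem_univ _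
        symm := ⟨fun _ _ h => h.symm⟩ }
    let φ : SimpleGraph.cycleGraph (m + 3) ≃g H'.coe :=
      { toEquiv := v.trans (Equiv.Set.univ _).symm
        map_rel_iff' := by
          intro a b
          change (SimpleGraph.cycleGraph (m + 3)).Adj (v.symm (v a)) (v.symm (v b)) ↔ _
          simp }
    obtain ⟨k, hk⟩ := hc H' ⟨φ⟩
    refine ⟨k, ?_⟩
    rw [ncard_colour_class c H' φ k] at hk
    exact hk
  · rintro hv H' ⟨φ⟩
    have hinj : Function.Injective fun i => (φ i : Fin (m + 3)) :=
      Subtype.val_injective.comp φ.injective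
    obtain ⟨k, hk⟩ := hv (Equiv.ofBijective _ (Finite.injective_iff_bijective.1 hinj))
    refine ⟨k, ?_⟩
    rw [ncard_colour_class c H' φ k]
    exact hk

/-! ### Switchable four-vertex paths -/

/-- A path `a i j b`, which can be switched to `a j i b`. -/
structure Gadget (V : Type*) where
  a : V
  i : V
  j : V
  b : V

namespace Gadget

variable {V X : Type*}

/-- The vertices of a gadget in path order. -/
def verts (g : Gadget V) : List V := [g.a, g.i, g.j, g.b]

/-- The change of the weight of the path when the gadget is switched. -/
def vec [Add X] (c : V → V → X) (g : Gadget V) : X :=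
  c g.a g.i + c g.j g.b + (c g.a g.j + c g.i g.b)

end Gadget

section Flat

variable {V X : Type*} [AddCommGroup X] [Module (ZMod 2) X]

/-- Every four-cycle in `A` has weight in `L`. -/
def Flat (c : V → V → X) (L : Submodule (ZMod 2) X) (A : Finset V) : Prop :=
  ∀ g : Gadget V, (∀ v ∈ g.verts, v ∈ A) → g.verts.Nodup → g.vec c ∈ L

/-- The span of the weights of a list of gadgets. -/
def gadgetSpan (c : V → V → X) (gs : List (Gadget V)) : Submodule (ZMod 2) X :=
  Submodule.span (ZMod 2) {x | x ∈ gs.map (Gadget.vec c)}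

/-- All vertices of a list of gadgets. -/
def gadgetVerts (gs : List (Gadget V)) : List V := gs.flatMap Gadget.verts

theorem length_gadgetVerts (gs : List (Gadget V)) :
    (gadgetVerts gs).length = 4 * gs.length := by
  induction gs with
  | nil => rfl
  | cons g gs ih =>
    simp only [gadgetVerts, List.flatMap_cons, List.length_append, List.length_cons] at ih ⊢
    rw [ih]
    simp only [Gadget.verts, List.length_cons, List.length_nil]
    omega

theorem gadgetVerts_cons (g : Gadget V) (gs : List (Gadget V)) :
    gadgetVerts (g :: gs) = g.verts ++ gadgetVerts gs := rfl

theorem gadgetSpan_cons (c : V → V → X) (g : Gadget V) (gs : List (Gadget V)) :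
    gadgetSpan c (g :: gs) = Submodule.span (ZMod 2) {g.vec c} ⊔ gadgetSpan c gs := by
  rw [gadgetSpan, gadgetSpan, ← Submodule.span_union]
  congr 1
  ext x
  simp

theorem gadgetSpan_perm (c : V → V → X) {gs gs' : List (Gadget V)} (h : gs.Perm gs') :
    gadgetSpan c gs = gadgetSpan c gs' := by
  unfold gadgetSpan
  congr 1
  ext x
  exact (h.map _).mem_iff

theorem mem_gadgetVerts {gs : List (Gadget V)} {v : V} :
    v ∈ gadgetVerts gs ↔ ∃ g ∈ gs, v ∈ g.verts := List.mem_flatMap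

variable [FiniteDimensional (ZMod 2) X]

theorem finrank_gadgetSpan_le (c : V → V → X) (gs : List (Gadget V)) :
    Module.finrank (ZMod 2) (gadgetSpan c gs) ≤ gs.length := by
  induction gs with
  | nil =>
    have : gadgetSpan c ([] : List (Gadget V)) = ⊥ := by simp [gadgetSpan]
    rw [this, finrank_bot]; exact Nat.zero_le _
  | cons g gs ih =>
    rw [gadgetSpan_cons, List.length_cons]
    refine (Submodule.finrank_add_le_finrank_add_finrank _ _).trans ?_
    have := finrank_span_le_card (R := ZMod 2) ({g.vec c} : Set X)
    simp only [Set.toFinset_singleton, Finset.card_singleton] at this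
    omega

theorem finrank_gadgetSpan_cons (c : V → V → X) {g : Gadget V} {gs : List (Gadget V)}
    (h : g.vec c ∉ gadgetSpan c gs) :
    Module.finrank (ZMod 2) (gadgetSpan c gs) + 1 ≤
      Module.finrank (ZMod 2) (gadgetSpan c (g :: gs)) := by
  apply Submodule.finrank_lt_finrank_of_lt
  rw [gadgetSpan_cons]
  refine lt_of_le_of_ne le_sup_right fun he => h ?_
  rw [he]
  exact le_sup_left (a := Submodule.span (ZMod 2) {g.vec c})
    (Submodule.mem_span_singleton_self _)

/-- Vertex-disjoint gadgets in `U` with linearly independent weights. -/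
structure IsGadgetFamily (c : V → V → X) (U : Finset V) (gs : List (Gadget V)) : Prop where
  nodup : (gadgetVerts gs).Nodup
  subset : ∀ v ∈ gadgetVerts gs, v ∈ U
  length_le : gs.length ≤ Module.finrank (ZMod 2) (gadgetSpan c gs)

theorem exists_maximal_family (c : V → V → X) (U : Finset V) :
    ∃ gs, IsGadgetFamily c U gs ∧ ∀ gs', IsGadgetFamily c U gs' → gs'.length ≤ gs.length := by
  classical
  let P : ℕ → Prop := fun n => ∃ gs, IsGadgetFamily c U gs ∧ gs.length = n
  have hb : ∀ n, P n → n ≤ Module.finrank (ZMod 2) X := by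
    rintro n ⟨gs, h, rfl⟩
    exact h.length_le.trans (Submodule.finrank_le _)
  have h0 : P 0 := ⟨[], ⟨List.nodup_nil, by simp [gadgetVerts], Nat.zero_le _⟩, rfl⟩
  obtain ⟨gs, h, hl⟩ := Nat.findGreatest_spec (P := P) (Nat.zero_le _) h0
  refine ⟨gs, h, fun gs' h' => ?_⟩
  rw [hl]
  exact Nat.le_findGreatest (hb _ ⟨gs', h', rfl⟩) ⟨gs', h', rfl⟩

variable [DecidableEq V]

/-- A large flat set together with gadgets that see it as flat and span all its four-cycles. -/
structure IsCore (c : V → V → X) (gs : List (Gadget V)) (R : Finset V) : Prop where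
  nodup : (gadgetVerts gs).Nodup
  disj : ∀ v ∈ gadgetVerts gs, v ∉ R
  length_le : gs.length ≤ Module.finrank (ZMod 2) (gadgetSpan c gs)
  flat : Flat c (gadgetSpan c gs) R
  flat_union : ∀ g ∈ gs, Flat c (gadgetSpan c gs) (R ∪ g.verts.toFinset)

/-- Remove a maximal gadget family from `U`. By maximality the remainder is flat over its span. If
adding back some gadget destroys flatness, an exchange gives a set flat over a space of dimension
smaller by at least two, and the induction on `D` applies. -/
theorem exists_core (c : V → V → X) (M : ℕ) :
    ∀ (D : ℕ) (U : Finset V) (L : Submodule (ZMod 2) X), Flat c L U →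
      Module.finrank (ZMod 2) L ≤ D → D * D + 3 * D + M ≤ U.card →
      ∃ gs R, IsCore c gs R ∧ M ≤ R.card := by
  intro D
  induction D using Nat.strong_induction_on with
  | _ D IH =>
  intro U L hL hD hU
  obtain ⟨gs, hgs, hmax⟩ := exists_maximal_family c U
  set Y := gadgetSpan c gs with hY
  set R := U \ (gadgetVerts gs).toFinset with hR
  have hYL : Y ≤ L := by
    rw [hY, gadgetSpan, Submodule.span_le]
    intro x hx
    obtain ⟨g, hg, rfl⟩ := List.mem_map.1 hx
    refine hL g (fun v hv => hgs.subset v (mem_gadgetVerts.2 ⟨g, hg, hv⟩)) ?_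
    exact (List.nodup_flatMap.1 hgs.nodup).1 g hg
  have hRcard : U.card ≤ R.card + 4 * gs.length := by
    have h1 : _ ≤ R.card := Finset.le_card_sdiff (gadgetVerts gs).toFinset U
    have h2 := List.toFinset_card_le (gadgetVerts gs)
    rw [length_gadgetVerts] at h2
    omega
  have hlen : gs.length ≤ Module.finrank (ZMod 2) Y := hgs.length_le
  have hYD : Module.finrank (ZMod 2) Y ≤ D := (Submodule.finrank_mono hYL).trans hD
  have hflat : Flat c Y R := by
    intro q hq hqn
    by_contra hqY
    have := hmax (q :: gs) ⟨?_, ?_, ?_⟩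
    · simp at this
    · rw [gadgetVerts_cons, List.nodup_append']
      refine ⟨hqn, hgs.nodup, fun v hv hv' => ?_⟩
      have := hq v hv
      rw [hR, Finset.mem_sdiff, List.mem_toFinset] at this
      exact this.2 hv'
    · intro v hv
      rw [gadgetVerts_cons, List.mem_append] at hv
      rcases hv with hv | hv
      · exact (Finset.mem_sdiff.1 (hq v hv)).1
      · exact hgs.subset v hv
    · have : Module.finrank (ZMod 2) Y + 1 ≤ _ := finrank_gadgetSpan_cons c hqY
      rw [List.length_cons]
      omega
  by_cases hgood : ∀ g ∈ gs, Flat c Y (R ∪ g.verts.toFinset)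
  · refine ⟨gs, R, ⟨hgs.nodup, fun v hv => ?_, hlen, hflat, hgood⟩, ?_⟩
    · rw [hR, Finset.mem_sdiff, List.mem_toFinset]
      exact fun h => h.2 hv
    · have : gs.length ≤ D := hlen.trans hYD
      have : D ≤ D * D := Nat.le_mul_self D
      omega
  push Not at hgood
  obtain ⟨g, hg, hbad⟩ := hgood
  unfold Flat at hbad
  push Not at hbad
  obtain ⟨p, hp, hpn, hpY⟩ := hbad
  classical
  have hperm := List.perm_cons_erase hg
  set gs' := gs.erase g with hgs'
  have hvperm : (gadgetVerts gs).Perm (g.verts ++ gadgetVerts gs') := by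
    rw [← gadgetVerts_cons]
    exact hperm.flatMap_right _
  have hnd := hvperm.nodup_iff.1 hgs.nodup
  rw [List.nodup_append'] at hnd
  have hYcons : Y = gadgetSpan c (g :: gs') := gadgetSpan_perm c hperm
  have hY'Y : gadgetSpan c gs' ≤ Y := by
    rw [hYcons, gadgetSpan_cons]; exact le_sup_right
  have hlen' : gs.length = gs'.length + 1 := by
    rw [hperm.length_eq, List.length_cons]
  have hlenY' : gs'.length ≤ Module.finrank (ZMod 2) (gadgetSpan c gs') := by
    have h1 : Module.finrank (ZMod 2) Y ≤
        1 + Module.finrank (ZMod 2) (gadgetSpan c gs') := by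
      rw [hYcons, gadgetSpan_cons]
      refine (Submodule.finrank_add_le_finrank_add_finrank _ _).trans ?_
      have := finrank_span_le_card (R := ZMod 2) ({g.vec c} : Set X)
      simp only [Set.toFinset_singleton, Finset.card_singleton] at this
      omega
    omega
  have hpU : ∀ v ∈ p.verts, v ∈ U ∧ v ∉ gadgetVerts gs' := by
    intro v hv
    rcases Finset.mem_union.1 (hp v hv) with h | h
    · rw [hR, Finset.mem_sdiff, List.mem_toFinset] at h
      refine ⟨h.1, fun h' => h.2 (hvperm.mem_iff.2 (List.mem_append_right _ h'))⟩
    · rw [List.mem_toFinset] at h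
      exact ⟨hgs.subset v (hvperm.mem_iff.2 (List.mem_append_left _ h)), hnd.2.2 h⟩
  -- The bad four-cycle `p` may meet `g` but no other gadget, so it can replace `g`. A four-cycle
  -- `q` in `U'` with weight outside the span of `gs'` would then make `p :: q :: gs'` a larger
  -- family than `gs`.
  set U' := R \ p.verts.toFinset with hU'
  have hflat' : Flat c (gadgetSpan c gs') U' := by
    intro q hq hqn
    by_contra hqY
    have hqR : ∀ v ∈ q.verts, v ∈ U ∧ v ∉ gadgetVerts gs ∧ v ∉ p.verts := by
      intro v hv
      have := hq v hv
      rw [hU', hR, Finset.mem_sdiff, Finset.mem_sdiff, List.mem_toFinset, List.mem_toFinset] at this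
      exact ⟨this.1.1, this.1.2, this.2⟩
    have hqY' : q.vec c ∈ Y :=
      hflat q (fun v hv => (Finset.mem_sdiff.1 (hq v hv)).1) hqn
    have hqle : gadgetSpan c (q :: gs') ≤ Y := by
      rw [gadgetSpan_cons]
      refine sup_le ?_ hY'Y
      rw [Submodule.span_singleton_le_iff_mem]
      exact hqY'
    have h1 := finrank_gadgetSpan_cons c hqY
    have h2 := finrank_gadgetSpan_cons c (g := p) (gs := q :: gs') fun h => hpY (hqle h)
    have := hmax (p :: q :: gs') ⟨?_, ?_, ?_⟩
    · simp only [List.length_cons] at this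
      omega
    · rw [gadgetVerts_cons, gadgetVerts_cons, List.nodup_append', List.nodup_append']
      refine ⟨hpn, ⟨hqn, hnd.2.1, fun v hv hv' => ?_⟩, fun v hv hv' => ?_⟩
      · exact (hqR v hv).2.1 (hvperm.mem_iff.2 (List.mem_append_right _ hv'))
      · rcases List.mem_append.1 hv' with h | h
        · exact (hqR v h).2.2 hv
        · exact (hpU v hv).2 h
    · intro v hv
      rw [gadgetVerts_cons, gadgetVerts_cons, List.mem_append, List.mem_append] at hv
      rcases hv with hv | hv | hv
      · exact (hpU v hv).1
      · exact (hqR v hv).1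
      · exact hgs.subset v (hvperm.mem_iff.2 (List.mem_append_right _ hv))
    · simp only [List.length_cons]
      omega
  have hpL : p.vec c ∈ L := hL p (fun v hv => (hpU v hv).1) hpn
  have hYlt : Module.finrank (ZMod 2) Y < Module.finrank (ZMod 2) L :=
    Submodule.finrank_lt_finrank_of_lt
      (lt_of_le_of_ne hYL fun h => hpY (h ▸ hpL))
  have hfr := finrank_gadgetSpan_le c gs'
  have hU'card : R.card ≤ U'.card + 4 := by
    have h1 : _ ≤ U'.card := Finset.le_card_sdiff p.verts.toFinset R
    have h2 := List.toFinset_card_le p.verts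
    have h3 : p.verts.length = 4 := rfl
    omega
  -- Here `gs.length ≤ D - 1`, so at most `4 * (D - 1) + 4 = 4 * D` vertices are lost, while `D * D
  -- + 3 * D` falls by `4 * D + 2` as `D` falls by two.
  obtain ⟨E, rfl⟩ : ∃ E, D = E + 2 := ⟨D - 2, by omega⟩
  refine IH E (by omega) U' _ hflat' (by omega) ?_
  have : (E + 2) * (E + 2) = E * E + 4 * E + 4 := by ring
  omega

end Flat

/-! ### Absorbing the remaining vertices -/

section Template

variable {V X : Type*} [AddCommGroup X]

/-- The weight `c` normalised by a vertex potential and a constant. -/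
def normWeight (c : V → V → X) (f : V → X) (κ : X) (x y : V) : X :=
  c x y + f x + f y + κ

theorem normWeight_comm {c : V → V → X} (hc : ∀ x y, c x y = c y x) (f : V → X) (κ : X)
    (x y : V) : normWeight c f κ x y = normWeight c f κ y x := by
  simp only [normWeight, hc x y]; abel

/-- The weight of a triangle. -/
def triWeight (c : V → V → X) (a x y : V) : X := c a x + c a y + c x y

theorem triWeight_comm {c : V → V → X} (hc : ∀ x y, c x y = c y x) (a x y : V) :
    triWeight c a x y = triWeight c a y x := by
  simp only [triWeight, hc x y]; abel

variable [Module (ZMod 2) X]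

/-- The scalar forces coefficients to be compared in `ZMod 2`, where cancellation in characteristic
two is decidable. -/
theorem eq_of_one_smul_eq {a b : X} (h : (1 : ZMod 2) • a = b) : a = b := by
  rwa [one_smul] at h

theorem add_self_zmod_two (a : X) : a + a = 0 :=
  eq_of_one_smul_eq (by match_scalars; decide)

theorem Flat.triWeight_add_mem {c : V → V → X} (hc : ∀ x y, c x y = c y x)
    {L : Submodule (ZMod 2) X} {A : Finset V} (hA : Flat c L A) {a x y z : V} (ha : a ∈ A)
    (hx : x ∈ A) (hy : y ∈ A) (hz : z ∈ A) (hax : a ≠ x) (hay : a ≠ y) (haz : a ≠ z)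
    (hxy : x ≠ y) (hxz : x ≠ z) : triWeight c a x y + triWeight c a x z ∈ L := by
  by_cases hyz : y = z
  · subst hyz
    rw [add_self_zmod_two]
    exact L.zero_mem
  have := hA ⟨a, y, z, x⟩ (by simp [Gadget.verts, *]) (by
    simp [Gadget.verts, *, hxy.symm, hxz.symm])
  convert this using 1
  simp only [triWeight, Gadget.vec, hc y x, hc z x]
  exact eq_of_one_smul_eq (by match_scalars <;> decide)

/-- Flatness makes all triangles at a fixed vertex `u` congruent modulo `L`; their common weight is
`κ`, and `f x = c u x`. Both are chosen from `R` alone, before `L` and `A`, so one potential serves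
`R` enlarged by any of the gadgets. The special value at `u` makes edges at `u` have normalised
weight zero. -/
theorem Flat.exists_potential [DecidableEq V] {c : V → V → X} (hc : ∀ x y, c x y = c y x)
    {R : Finset V} (hR : 3 ≤ R.card) :
    ∃ f κ, ∀ (L : Submodule (ZMod 2) X) (A : Finset V), R ⊆ A → Flat c L A →
      ∀ x ∈ A, ∀ y ∈ A, x ≠ y → normWeight c f κ x y ∈ L := by
  obtain ⟨u, hu, v, hv, w, hw, huv, huw, hvw⟩ := Finset.two_lt_card.1 hR
  refine ⟨fun x => if x = u then triWeight c u v w else c u x, triWeight c u v w, ?_⟩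
  intro L A hRA hA
  have huA := hRA hu
  have hvA := hRA hv
  have hwA := hRA hw
  have hbase : ∀ x, x ≠ u →
      normWeight c (fun x => if x = u then triWeight c u v w else c u x)
        (triWeight c u v w) x u = 0 := by
    intro x hx
    simp only [normWeight, if_neg hx, if_true, hc x u]
    exact eq_of_one_smul_eq (by match_scalars <;> decide)
  intro x hx y hy hxy
  by_cases hxu : x = u
  · subst hxu
    rw [normWeight_comm hc, hbase y hxy.symm]
    exact L.zero_mem
  by_cases hyu : y = u
  · subst hyu
    rw [hbase x hxy]
    exact L.zero_mem
  have key : triWeight c u x y + triWeight c u v w ∈ L := by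
    by_cases hxv : x = v
    · subst hxv
      exact hA.triWeight_add_mem hc huA hx hy hwA huv (Ne.symm hyu) huw hxy hvw
    · have h1 := hA.triWeight_add_mem hc huA hx hy hvA (Ne.symm hxu) (Ne.symm hyu) huv hxy hxv
      have h2 := hA.triWeight_add_mem hc huA hvA hx hwA huv (Ne.symm hxu) huw (Ne.symm hxv) hvw
      rw [triWeight_comm hc u v x] at h2
      convert L.add_mem h1 h2 using 1
      exact eq_of_one_smul_eq (by match_scalars <;> decide)
  convert key using 1
  simp only [normWeight, if_neg hxu, if_neg hyu, triWeight]
  abel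

/-- Gadgets which fit into a flat set `A` and whose ends connect to a subset `R` of `A`. -/
structure IsTemplate (c : V → V → X) (κ : X) (f : V → X) (gs : List (Gadget V))
    (A R : Finset V) : Prop where
  nodup : (gadgetVerts gs).Nodup
  disj : ∀ v ∈ gadgetVerts gs, v ∉ A
  subset : R ⊆ A
  length_le : gs.length ≤ Module.finrank (ZMod 2) (gadgetSpan c gs)
  flat : ∀ x ∈ A, ∀ y ∈ A, x ≠ y → normWeight c f κ x y ∈ gadgetSpan c gs
  left : ∀ g ∈ gs, ∀ u ∈ R, normWeight c f κ u g.a ∈ gadgetSpan c gs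
  right : ∀ g ∈ gs, ∀ u ∈ R, normWeight c f κ g.b u ∈ gadgetSpan c gs
  path : ∀ g ∈ gs, normWeight c f κ g.a g.i + normWeight c f κ g.i g.j +
    normWeight c f κ g.j g.b ∈ gadgetSpan c gs

theorem IsCore.exists_template [DecidableEq V] {c : V → V → X} (hc : ∀ x y, c x y = c y x)
    {gs : List (Gadget V)} {R : Finset V} (h : IsCore c gs R) (hR : 3 ≤ R.card) :
    ∃ κ f, IsTemplate c κ f gs R R := by
  obtain ⟨f, κ, hf⟩ := Flat.exists_potential hc hR
  have hnd : ∀ g ∈ gs, g.verts.Nodup := (List.nodup_flatMap.1 h.nodup).1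
  have hmem : ∀ g ∈ gs, ∀ v ∈ g.verts, ∀ u ∈ R, v ≠ u := by
    rintro g hg v hv u hu rfl
    exact h.disj _ (mem_gadgetVerts.2 ⟨g, hg, hv⟩) hu
  have hU : ∀ g ∈ gs, ∀ x ∈ R ∪ g.verts.toFinset, ∀ y ∈ R ∪ g.verts.toFinset, x ≠ y →
      normWeight c f κ x y ∈ gadgetSpan c gs := fun g hg =>
    hf _ _ Finset.subset_union_left (h.flat_union g hg)
  refine ⟨κ, f, h.nodup, h.disj, subset_rfl, h.length_le, hf _ _ subset_rfl h.flat,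
    fun g hg u hu => ?_, fun g hg u hu => ?_, fun g hg => ?_⟩
  · refine hU g hg _ (Finset.mem_union_left _ hu) _ ?_ (hmem g hg g.a ?_ u hu).symm
    · simp [Gadget.verts]
    · simp [Gadget.verts]
  · refine hU g hg _ ?_ _ (Finset.mem_union_left _ hu) (hmem g hg g.b ?_ u hu)
    · simp [Gadget.verts]
    · simp [Gadget.verts]
  · have hn := hnd g hg
    simp only [Gadget.verts, List.nodup_cons, List.mem_cons, List.not_mem_nil, or_false,
      not_or] at hn
    refine Submodule.add_mem _ (Submodule.add_mem _ ?_ ?_) ?_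
    · exact hU g hg _ (by simp [Gadget.verts]) _ (by simp [Gadget.verts]) hn.1.1
    · exact hU g hg _ (by simp [Gadget.verts]) _ (by simp [Gadget.verts]) hn.2.1.1
    · exact hU g hg _ (by simp [Gadget.verts]) _ (by simp [Gadget.verts]) hn.2.2.1

/-- A constant error from `v` to `A` is absorbed by shifting the potential at `v`. The set `R` does
not grow, since nothing is known about edges from `v` to gadget ends. -/
theorem IsTemplate.insert_vertex [DecidableEq V] {c : V → V → X} (hc : ∀ x y, c x y = c y x)
    {κ : X} {f : V → X} {gs : List (Gadget V)} {A R : Finset V} (h : IsTemplate c κ f gs A R)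
    {v : V} (hvA : v ∉ A) (hvg : v ∉ gadgetVerts gs) (s : X)
    (hs : ∀ u ∈ A, normWeight c f κ v u + s ∈ gadgetSpan c gs) :
    IsTemplate c κ (Function.update f v (f v + s)) gs (insert v A) R := by
  have hne : ∀ x y, x ≠ v → y ≠ v →
      normWeight c (Function.update f v (f v + s)) κ x y = normWeight c f κ x y := by
    intro x y hx hy
    simp only [normWeight, Function.update_of_ne hx, Function.update_of_ne hy]
  have hA : ∀ u ∈ A, u ≠ v := fun u hu h => hvA (h ▸ hu)
  have hg : ∀ g ∈ gs, ∀ u ∈ g.verts, u ≠ v := fun g hg u hu h =>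
    hvg (h ▸ mem_gadgetVerts.2 ⟨g, hg, hu⟩)
  have hv : ∀ u ∈ A, normWeight c (Function.update f v (f v + s)) κ v u ∈ gadgetSpan c gs := by
    intro u hu
    convert hs u hu using 1
    simp only [normWeight, Function.update_self, Function.update_of_ne (hA u hu)]
    abel
  refine ⟨h.nodup, fun u hu hu' => ?_, h.subset.trans (Finset.subset_insert _ _), h.length_le,
    fun x hx y hy hxy => ?_, fun g hgs u hu => ?_, fun g hgs u hu => ?_, fun g hgs => ?_⟩
  · rcases Finset.mem_insert.1 hu' with rfl | hu'
    · exact hvg hu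
    · exact h.disj u hu hu'
  · rcases Finset.mem_insert.1 hx with rfl | hx'
    · exact hv y (Finset.mem_of_mem_insert_of_ne hy hxy.symm)
    · rcases Finset.mem_insert.1 hy with rfl | hy
      · rw [normWeight_comm hc]
        exact hv x hx'
      · rw [hne x y (hA x hx') (hA y hy)]
        exact h.flat x hx' y hy hxy
  · rw [hne _ _ (hA u (h.subset hu)) (hg g hgs _ (by simp [Gadget.verts]))]
    exact h.left g hgs u hu
  · rw [hne _ _ (hg g hgs _ (by simp [Gadget.verts])) (hA u (h.subset hu))]
    exact h.right g hgs u hu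
  · rw [hne _ _ (hg g hgs _ (by simp [Gadget.verts])) (hg g hgs _ (by simp [Gadget.verts])),
      hne _ _ (hg g hgs _ (by simp [Gadget.verts])) (hg g hgs _ (by simp [Gadget.verts])),
      hne _ _ (hg g hgs _ (by simp [Gadget.verts])) (hg g hgs _ (by simp [Gadget.verts]))]
    exact h.path g hgs

variable [FiniteDimensional (ZMod 2) X]

/-- Modulo `L` the edges inside `A` vanish after normalisation. So the path `x v w y` has weight
given by `hsame`, and its switch changes the weight by the sum in `hdiff`, which is new. -/
theorem IsTemplate.cons_gadget [DecidableEq V] {c : V → V → X} (hc : ∀ x y, c x y = c y x)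
    {κ : X} {f : V → X} {gs : List (Gadget V)} {A R : Finset V} (h : IsTemplate c κ f gs A R)
    {v x w y : V} (hvA : v ∉ A) (hvg : v ∉ gadgetVerts gs) (hx : x ∈ A) (hw : w ∈ A) (hy : y ∈ A)
    (hxw : x ≠ w) (hsame : normWeight c f κ v x + normWeight c f κ v w ∈ gadgetSpan c gs)
    (hdiff : normWeight c f κ v y + normWeight c f κ v x ∉ gadgetSpan c gs) :
    IsTemplate c κ f (⟨x, v, w, y⟩ :: gs) (A \ {x, w, y}) (R \ {x, w, y}) ∧
      Module.finrank (ZMod 2) (gadgetSpan c gs) + 1 ≤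
        Module.finrank (ZMod 2) (gadgetSpan c (⟨x, v, w, y⟩ :: gs)) := by
  set L := gadgetSpan c gs with hL
  have hyx : y ≠ x := by
    rintro rfl
    rw [add_self_zmod_two] at hdiff
    exact hdiff L.zero_mem
  have hyw : y ≠ w := by
    rintro rfl
    rw [add_comm] at hdiff
    exact hdiff hsame
  have hAv : ∀ u ∈ A, u ≠ v := fun u hu h => hvA (h ▸ hu)
  have hwy := h.flat w hw y hy hyw.symm
  have hxw' := h.flat x hx w hw hxw
  have hvec : (⟨x, v, w, y⟩ : Gadget V).vec c ∉ L := by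
    intro hmem
    apply hdiff
    convert L.add_mem hmem (L.add_mem hwy hxw') using 1
    simp only [Gadget.vec, normWeight, hc x v]
    exact eq_of_one_smul_eq (by match_scalars <;> decide)
  have hrank := finrank_gadgetSpan_cons c hvec
  have hle : L ≤ gadgetSpan c (⟨x, v, w, y⟩ :: gs) := by
    rw [gadgetSpan_cons]; exact le_sup_right
  refine ⟨⟨?_, ?_, Finset.sdiff_subset_sdiff h.subset subset_rfl, ?_, ?_, ?_, ?_, ?_⟩, hrank⟩
  · rw [gadgetVerts_cons, List.nodup_append']
    refine ⟨?_, h.nodup, ?_⟩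
    · simp only [Gadget.verts, List.nodup_cons, List.mem_cons, List.not_mem_nil, or_false, not_or,
        not_false_eq_true, List.nodup_nil, and_true]
      exact ⟨⟨hAv x hx, hxw, hyx.symm⟩, ⟨(hAv w hw).symm, (hAv y hy).symm⟩, hyw.symm⟩
    · intro u hu hu'
      simp only [Gadget.verts, List.mem_cons, List.not_mem_nil, or_false] at hu
      rcases hu with rfl | rfl | rfl | rfl
      · exact h.disj _ hu' hx
      · exact hvg hu'
      · exact h.disj _ hu' hw
      · exact h.disj _ hu' hy
  · intro u hu
    rw [gadgetVerts_cons, List.mem_append] at hu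
    rcases hu with hu | hu
    · simp only [Gadget.verts, List.mem_cons, List.not_mem_nil, or_false] at hu
      rcases hu with rfl | rfl | rfl | rfl <;> simp [hvA]
    · exact fun h' => h.disj u hu (Finset.mem_sdiff.1 h').1
  · have := h.length_le
    rw [List.length_cons]
    omega
  · intro p hp q hq hpq
    exact hle (h.flat p (Finset.mem_sdiff.1 hp).1 q (Finset.mem_sdiff.1 hq).1 hpq)
  · intro g hg u hu
    rw [Finset.mem_sdiff] at hu
    rcases List.mem_cons.1 hg with rfl | hg
    · refine hle (h.flat u (h.subset hu.1) x hx ?_)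
      rintro rfl
      exact hu.2 (by simp)
    · exact hle (h.left g hg u hu.1)
  · intro g hg u hu
    rw [Finset.mem_sdiff] at hu
    rcases List.mem_cons.1 hg with rfl | hg
    · refine hle (h.flat y hy u (h.subset hu.1) ?_)
      rintro rfl
      exact hu.2 (by simp)
    · exact hle (h.right g hg u hu.1)
  · intro g hg
    rcases List.mem_cons.1 hg with rfl | hg
    · refine hle (L.add_mem ?_ hwy)
      convert hsame using 2
      exact normWeight_comm hc f κ x v
    · exact hle (h.path g hg)

/-- A new gadget costs `R` at most three vertices but raises the rank, so `R.card` plus three times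
the rank never decreases. The induction is on the number of vertices not yet absorbed. -/
theorem IsTemplate.exists_full [Fintype V] [DecidableEq V] {K : Type*} [Fintype K]
    {c : V → V → X} (hc : ∀ x y, c x y = c y x) (col : V → V → K) (e : K → X)
    (hcol : ∀ x y, c x y = e (col x y)) (κ : X) {M : ℕ}
    (hM : Fintype.card K * Fintype.card K + 2 ≤ M) :
    ∀ (n : ℕ) (f : V → X) (gs : List (Gadget V)) (A R : Finset V), IsTemplate c κ f gs A R →
      (Finset.univ.filter fun v => v ∉ A ∧ v ∉ gadgetVerts gs).card ≤ n →
      M + 3 * Module.finrank (ZMod 2) X ≤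
        R.card + 3 * Module.finrank (ZMod 2) (gadgetSpan c gs) →
      ∃ f gs A R, IsTemplate c κ f gs A R ∧ (∀ v, v ∉ A → v ∈ gadgetVerts gs) ∧ M ≤ R.card := by
  intro n
  induction n with
  | zero =>
    intro f gs A R h hn hR
    have := Submodule.finrank_le (gadgetSpan c gs)
    refine ⟨f, gs, A, R, h, fun v hv => ?_, by omega⟩
    by_contra hv'
    have hmem : v ∈ Finset.univ.filter fun v => v ∉ A ∧ v ∉ gadgetVerts gs := by
      simp [hv, hv']
    have := Finset.card_pos.2 ⟨v, hmem⟩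
    omega
  | succ n ih =>
    intro f gs A R h hn hR
    have hfr := Submodule.finrank_le (gadgetSpan c gs)
    by_cases hall : ∀ v, v ∉ A → v ∈ gadgetVerts gs
    · exact ⟨f, gs, A, R, h, hall, by omega⟩
    push Not at hall
    obtain ⟨v, hvA, hvg⟩ := hall
    have hdec : ∀ (A' : Finset V) (gs' : List (Gadget V)),
        (∀ u, (u ∈ A ∨ u ∈ gadgetVerts gs ∨ u = v) → (u ∈ A' ∨ u ∈ gadgetVerts gs')) →
        (Finset.univ.filter fun v => v ∉ A' ∧ v ∉ gadgetVerts gs').card ≤ n := by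
      intro A' gs' hsub
      have : (Finset.univ.filter fun v => v ∉ A' ∧ v ∉ gadgetVerts gs') ⊂
          Finset.univ.filter fun v => v ∉ A ∧ v ∉ gadgetVerts gs := by
        rw [Finset.ssubset_iff_of_subset]
        · refine ⟨v, by simp [hvA, hvg], ?_⟩
          have := hsub v (by simp)
          simp only [Finset.mem_filter, Finset.mem_univ, true_and]
          tauto
        · intro u
          have := hsub u
          simp only [Finset.mem_filter, Finset.mem_univ, true_and]
          tauto
      have := Finset.card_lt_card this
      omega
    by_cases hconst : ∃ s, ∀ u ∈ A, normWeight c f κ v u + s ∈ gadgetSpan c gs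
    · obtain ⟨s, hs⟩ := hconst
      refine ih _ _ _ _ (h.insert_vertex hc hvA hvg s hs) (hdec _ _ fun u hu => ?_) hR
      rw [Finset.mem_insert]
      tauto
    push Not at hconst
    obtain ⟨u₀, hu₀⟩ : R.Nonempty := Finset.card_pos.1 (by omega)
    -- Pigeonhole gives `x` and `w` with equal colours to `v` and equal colours to `u₀`. The edges
    -- to `u₀` show `f x + f w ∈ L`, hence `hsame`.
    have hcard : (Finset.univ : Finset (K × K)).card < (R.erase u₀).card := by
      rw [Finset.card_univ, Fintype.card_prod, Finset.card_erase_of_mem hu₀]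
      omega
    obtain ⟨x, hx, w, hw, hxw, heq⟩ := Finset.exists_ne_map_eq_of_card_lt_of_maps_to hcard
      (f := fun u => (col v u, col u u₀)) (fun _ _ => Finset.mem_univ _)
    rw [Finset.mem_erase] at hx hw
    simp only [Prod.mk.injEq] at heq
    have hxA := h.subset hx.2
    have hwA := h.subset hw.2
    have hsame : normWeight c f κ v x + normWeight c f κ v w ∈ gadgetSpan c gs := by
      convert (gadgetSpan c gs).add_mem (h.flat x hxA u₀ (h.subset hu₀) hx.1)
        (h.flat w hwA u₀ (h.subset hu₀) hw.1) using 1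
      simp only [normWeight, hcol, heq.1, heq.2]
      exact eq_of_one_smul_eq (by match_scalars <;> decide)
    obtain ⟨y, hyA, hy⟩ := hconst (normWeight c f κ v x)
    obtain ⟨h', hrank⟩ := h.cons_gadget hc hvA hvg hxA hwA hyA hxw hsame hy
    refine ih _ _ _ _ h' (hdec _ _ fun u hu => ?_) ?_
    · simp only [gadgetVerts_cons, Gadget.verts, List.mem_append, List.mem_cons, List.not_mem_nil,
        Finset.mem_sdiff, Finset.mem_insert, Finset.mem_singleton]
      tauto
    · have h1 := Finset.le_card_sdiff {x, w, y} R
      have h2 : ({x, w, y} : Finset V).card ≤ 3 := Finset.card_le_three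
      omega

end Template

/-! ### Assembling an even Hamilton cycle -/

/-- The total weight of the walk `x :: t`. -/
def pathSum {V X : Type*} [AddCommMonoid X] (w : V → V → X) : V → List V → X
  | _, [] => 0
  | x, y :: t => w x y + pathSum w y t

/-- The path through a list of gadgets, with a connecting vertex after each of them. -/
def gadgetBlocks {V : Type*} (bs : List (Gadget V × V)) : List V :=
  bs.flatMap fun p => [p.1.a, p.1.i, p.1.j, p.1.b, p.2]

section PathSum

variable {V X : Type*} [AddCommGroup X]

theorem gadgetBlocks_cons (p : Gadget V × V) (bs : List (Gadget V × V)) :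
    gadgetBlocks (p :: bs) = p.1.a :: p.1.i :: p.1.j :: p.1.b :: p.2 :: gadgetBlocks bs := rfl

theorem gadgetBlocks_perm (bs : List (Gadget V × V)) :
    (gadgetBlocks bs).Perm (gadgetVerts (bs.map Prod.fst) ++ bs.map Prod.snd) := by
  induction bs with
  | nil => exact List.Perm.refl _
  | cons p bs ih =>
    rw [gadgetBlocks_cons, List.map_cons, List.map_cons, gadgetVerts_cons]
    simp only [Gadget.verts, List.cons_append, List.nil_append]
    refine List.Perm.cons _ (List.Perm.cons _ (List.Perm.cons _ (List.Perm.cons _ ?_)))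
    exact (ih.cons _).trans List.perm_middle.symm

theorem pathSum_eq_sum (w : V → V → X) (x : V) (t : List V) :
    pathSum w x t = ∑ i : Fin t.length, w ((x :: t)[i.val]'(by simp)) t[i.val] := by
  induction t generalizing x with
  | nil => rfl
  | cons y t ih =>
    rw [pathSum, ih]
    exact (Fin.sum_univ_succ (n := t.length) fun i : Fin (y :: t).length =>
      w ((x :: y :: t)[i.val]'(by simp)) (y :: t)[i.val]).symm

/-- The start `x` may equal `u`; a nonempty `l` keeps the closing edge from being a loop. -/
theorem pathSum_mem_of_path {w : V → V → X} {L : AddSubgroup X} {A : Finset V} {u : V}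
    (hA : ∀ x ∈ A, ∀ y ∈ A, x ≠ y → w x y ∈ L) (hu : u ∈ A) (l : List V) :
    ∀ x ∈ A, (∀ y ∈ l, y ∈ A) → (x :: l).Nodup → u ∉ l → l ≠ [] →
      pathSum w x (l ++ [u]) ∈ L := by
  induction l with
  | nil => intro x _ _ _ _ h; exact absurd rfl h
  | cons y t ih =>
    intro x hx hl hn hul _
    rw [List.cons_append, pathSum]
    rw [List.nodup_cons] at hn
    have hy : y ∈ A := hl y (by simp)
    refine L.add_mem (hA x hx y hy fun h => hn.1 (by simp [h])) ?_
    by_cases ht : t = []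
    · subst ht
      simp only [List.nil_append, pathSum, add_zero]
      exact hA y hy u hu fun h => hul (by simp [h])
    · exact ih y hy (fun z hz => hl z (by simp [hz])) hn.2 (fun h => hul (by simp [h])) ht

variable [Module (ZMod 2) X]

theorem pathSum_normWeight (c : V → V → X) (f : V → X) (κ : X) (x : V) (t : List V) :
    pathSum (normWeight c f κ) x t =
      pathSum c x t + f x + f (t.getLastD x) + t.length • κ := by
  induction t generalizing x with
  | nil =>
    simp only [pathSum, List.getLastD_nil, List.length_nil, zero_smul, zero_add, add_zero]
    exact (add_self_zmod_two _).symm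
  | cons y t ih =>
    rw [pathSum, ih, pathSum, List.getLastD_cons, List.length_cons, succ_nsmul, normWeight]
    have : f y + f y = 0 := add_self_zmod_two _
    calc _ = c x y + pathSum c y t + f x + f (t.getLastD y) + (t.length • κ + κ)
        + (f y + f y) := by abel
      _ = _ := by rw [this, add_zero]

/-- Around a closed walk each potential is counted twice, and even length cancels `κ`; this is where
the parity of `n` enters. -/
theorem pathSum_normWeight_closed (c : V → V → X) (f : V → X) (κ : X) (x : V) (t : List V)
    (h : Even (t ++ [x]).length) :
    pathSum (normWeight c f κ) x (t ++ [x]) = pathSum c x (t ++ [x]) := by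
  rw [pathSum_normWeight]
  obtain ⟨k, hk⟩ := h
  rw [hk, add_smul, add_self_zmod_two, List.getLastD_concat, add_assoc (pathSum _ _ _),
    add_self_zmod_two, add_zero, add_zero]

/-- Switching gadgets changes the weight of a path by any prescribed element of their span. -/
theorem exists_switch {c : V → V → X} (hc : ∀ x y, c x y = c y x) (bs : List (Gadget V × V)) :
    ∀ z ∈ gadgetSpan c (bs.map Prod.fst), ∃ l : List V, l.Perm (gadgetBlocks bs) ∧
      ∀ x t, pathSum c x (l ++ t) = pathSum c x (gadgetBlocks bs ++ t) + z := by
  induction bs with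
  | nil =>
    intro z hz
    have : z = 0 := by simpa [gadgetSpan] using hz
    subst this
    exact ⟨[], List.Perm.refl _, fun x t => (add_zero _).symm⟩
  | cons p bs ih =>
    intro z hz
    rw [List.map_cons, gadgetSpan_cons, Submodule.mem_sup] at hz
    obtain ⟨z₁, hz₁, z₂, hz₂, rfl⟩ := hz
    obtain ⟨s, rfl⟩ := Submodule.mem_span_singleton.1 hz₁
    obtain ⟨l, hl, hsum⟩ := ih z₂ hz₂
    have hs : s = 0 ∨ s = 1 := (by decide : ∀ s : ZMod 2, s = 0 ∨ s = 1) s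
    rcases hs with rfl | rfl
    · refine ⟨p.1.a :: p.1.i :: p.1.j :: p.1.b :: p.2 :: l, ?_, fun x t => ?_⟩
      · rw [gadgetBlocks_cons]
        exact (((((hl.cons _).cons _).cons _).cons _).cons _)
      · rw [gadgetBlocks_cons]
        simp only [List.cons_append, pathSum, hsum, zero_smul, zero_add]
        abel
    · refine ⟨p.1.a :: p.1.j :: p.1.i :: p.1.b :: p.2 :: l, ?_, fun x t => ?_⟩
      · rw [gadgetBlocks_cons]
        exact List.Perm.cons _ ((List.Perm.swap _ _ _).trans
          ((((hl.cons _).cons _).cons _).cons _))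
      · rw [gadgetBlocks_cons]
        simp only [List.cons_append, pathSum, hsum, Gadget.vec, hc p.1.j p.1.i]
        exact eq_of_one_smul_eq (by match_scalars <;> decide)

theorem IsTemplate.pathSum_mem {c : V → V → X} {κ : X} {f : V → X} {gs : List (Gadget V)}
    {A R : Finset V} (h : IsTemplate c κ f gs A R) {P : V → Prop} (hP : ∀ u, P u → u ∈ R)
    {t : List V} (ht : ∀ u, P u → pathSum (normWeight c f κ) u t ∈ gadgetSpan c gs)
    (bs : List (Gadget V × V)) :
    ∀ x, P x → (∀ p ∈ bs, p.1 ∈ gs ∧ P p.2) →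
      pathSum (normWeight c f κ) x (gadgetBlocks bs ++ t) ∈ gadgetSpan c gs := by
  induction bs with
  | nil => intro x hx _; exact ht x hx
  | cons p bs ih =>
    intro x hx hbs
    obtain ⟨hp, hpu⟩ := hbs p (by simp)
    have h1 := h.left _ hp x (hP x hx)
    have h2 := h.path _ hp
    have h3 := h.right _ hp _ (hP _ hpu)
    have h4 := ih p.2 hpu fun q hq => hbs q (by simp [hq])
    rw [gadgetBlocks_cons]
    simp only [List.cons_append, pathSum]
    convert Submodule.add_mem _ h1 (Submodule.add_mem _ h2 (Submodule.add_mem _ h3 h4)) using 1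
    abel

theorem IsTemplate.exists_even_cycle [Fintype V] [DecidableEq V] {c : V → V → X}
    (hc : ∀ x y, c x y = c y x) {κ : X}
    {f : V → X} {gs : List (Gadget V)} {A R : Finset V} (h : IsTemplate c κ f gs A R)
    (hall : ∀ v, v ∉ A → v ∈ gadgetVerts gs) (hR : gs.length + 2 ≤ R.card)
    (heven : Even (Fintype.card V)) :
    ∃ (u : V) (l : List V), (u :: l).Nodup ∧ (∀ v, v ∈ u :: l) ∧ pathSum c u (l ++ [u]) = 0 := by
  -- The cycle starts at `u`, and connectors come from `us`; `u'` is reserved so that the final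
  -- stretch `rest` is nonempty.
  obtain ⟨u, u', us, hus⟩ : ∃ u u' us, R.toList = u :: u' :: us := by
    have hl := Finset.length_toList R
    match hR' : R.toList with
    | [] => rw [hR', List.length_nil] at hl; omega
    | [_] => rw [hR', List.length_singleton] at hl; omega
    | u :: u' :: us => exact ⟨u, u', us, rfl⟩
  have hlen : gs.length ≤ us.length := by
    have hl := Finset.length_toList R
    rw [hus, List.length_cons, List.length_cons] at hl
    omega
  have hnd := Finset.nodup_toList R
  have hmem : ∀ v, v ∈ u :: u' :: us → v ∈ R := fun v hv => by
    rwa [← hus, Finset.mem_toList] at hv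
  rw [hus, List.nodup_cons, List.nodup_cons] at hnd
  set conn := us.take gs.length with hconn
  have hconnsub : ∀ v ∈ conn, v ∈ us := fun v hv => List.mem_of_mem_take hv
  have hconnlen : conn.length = gs.length := by simp [hconn, hlen]
  set bs := gs.zip conn with hbs
  have hfst : bs.map Prod.fst = gs := List.map_fst_zip hconnlen.ge
  have hsnd : bs.map Prod.snd = conn := List.map_snd_zip hconnlen.le
  have hperm : (gadgetBlocks bs).Perm (gadgetVerts gs ++ conn) := by
    have := gadgetBlocks_perm bs
    rwa [hfst, hsnd] at this
  have hconnR : ∀ v ∈ conn, v ∈ R := fun v hv => hmem v (by simp [hconnsub v hv])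
  have huR : u ∈ R := hmem u (by simp)
  have hu'R : u' ∈ R := hmem u' (by simp)
  have hgR : ∀ v ∈ gadgetVerts gs, v ∉ R := fun v hv hv' => h.disj v hv (h.subset hv')
  have hblocks : (u :: gadgetBlocks bs).Nodup := by
    rw [(hperm.cons u).nodup_iff, List.nodup_cons, List.mem_append, List.nodup_append']
    refine ⟨?_, h.nodup, ?_, fun v hv hv' => hgR v hv (hconnR v hv')⟩
    · rintro (hu | hu)
      · exact hgR u hu huR
      · exact hnd.1 (by simp [hconnsub u hu])
    · exact hnd.2.2.sublist (List.take_sublist _ _)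
  set rest := (Finset.univ.filter fun v => v ∉ u :: gadgetBlocks bs).toList with hrest
  have hmemrest : ∀ v, v ∈ rest ↔ v ∉ u :: gadgetBlocks bs := by
    intro v
    rw [hrest, Finset.mem_toList, Finset.mem_filter]
    simp only [Finset.mem_univ, true_and]
  have hrestA : ∀ v ∈ rest, v ∈ A := by
    intro v hv
    by_contra hvA
    refine (hmemrest v).1 hv (List.mem_cons_of_mem _ (hperm.mem_iff.2 ?_))
    exact List.mem_append_left _ (hall v hvA)
  have hu'rest : u' ∈ rest := by
    rw [hmemrest, List.mem_cons, hperm.mem_iff, List.mem_append]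
    rintro (rfl | h' | h')
    · exact hnd.1 (by simp)
    · exact hgR _ h' hu'R
    · exact hnd.2.1 (hconnsub _ h')
  let P : V → Prop := fun v => v ∈ R ∧ v ∉ rest
  have hPu : P u := ⟨huR, fun h' => (hmemrest u).1 h' (by simp)⟩
  have hsumL : pathSum (normWeight c f κ) u (gadgetBlocks bs ++ (rest ++ [u])) ∈
      gadgetSpan c gs := by
    refine h.pathSum_mem (P := P) (fun v hv => hv.1) (fun v hv => ?_) bs u hPu fun p hp => ?_
    · refine pathSum_mem_of_path (L := (gadgetSpan c gs).toAddSubgroup) h.flat (h.subset huR)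
        rest v (h.subset hv.1) hrestA ?_ hPu.2 (List.ne_nil_of_mem hu'rest)
      exact List.nodup_cons.2 ⟨hv.2, Finset.nodup_toList _⟩
    · have hp' : p.2 ∈ conn := (List.of_mem_zip hp).2
      refine ⟨(List.of_mem_zip hp).1, hconnR _ hp', fun h' => (hmemrest _).1 h' ?_⟩
      exact List.mem_cons_of_mem _ (hperm.mem_iff.2 (List.mem_append_right _ hp'))
  have hnodup : ∀ l : List V, l.Perm (gadgetBlocks bs) → (u :: (l ++ rest)).Nodup := by
    intro l hl
    rw [((hl.append_right rest).cons u).nodup_iff, ← List.cons_append, List.nodup_append']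
    exact ⟨hblocks, Finset.nodup_toList _, fun v hv hv' => (hmemrest v).1 hv' hv⟩
  have hcomplete : ∀ l : List V, l.Perm (gadgetBlocks bs) → ∀ v, v ∈ u :: (l ++ rest) := by
    intro l hl v
    rw [((hl.append_right rest).cons u).mem_iff, ← List.cons_append, List.mem_append, hmemrest]
    exact em _
  have hlength : Even ((gadgetBlocks bs ++ rest) ++ [u]).length := by
    have h1 := List.toFinset_card_of_nodup (hnodup _ (List.Perm.refl _))
    have h2 : (u :: (gadgetBlocks bs ++ rest)).toFinset = Finset.univ :=
      Finset.eq_univ_iff_forall.2 fun v =>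
        List.mem_toFinset.2 (hcomplete _ (List.Perm.refl _) v)
    rw [h2, Finset.card_univ, List.length_cons] at h1
    rw [List.length_append, List.length_singleton, ← h1]
    exact heven
  rw [← List.append_assoc, pathSum_normWeight_closed c f κ u _ hlength] at hsumL
  obtain ⟨l, hl, hsum⟩ := exists_switch hc bs _ (by rw [hfst]; exact hsumL)
  refine ⟨u, l ++ rest, hnodup l hl, hcomplete l hl, ?_⟩
  rw [List.append_assoc, hsum, List.append_assoc]
  exact add_self_zmod_two _

end PathSum

theorem exists_perm_sum_eq_zero {X : Type*} [AddCommGroup X] {m : ℕ}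
    (c : Fin (m + 3) → Fin (m + 3) → X) (u : Fin (m + 3)) (l : List (Fin (m + 3)))
    (hnd : (u :: l).Nodup) (hall : ∀ v, v ∈ u :: l) (h0 : pathSum c u (l ++ [u]) = 0) :
    ∃ v : Equiv.Perm (Fin (m + 3)), ∑ i, c (v i) (v (i + 1)) = 0 := by
  have hlen : l.length = m + 2 := by
    have h1 := List.toFinset_card_of_nodup hnd
    rw [Finset.eq_univ_iff_forall.2 fun v => List.mem_toFinset.2 (hall v), Finset.card_univ,
      Fintype.card_fin, List.length_cons] at h1
    omega
  let w : Fin (m + 3) → Fin (m + 3) := fun i => (u :: l)[i.val]'(by simp only [List.length_cons]; omega)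
  have hw : Function.Injective w := by
    intro i j hij
    exact Fin.ext ((List.Nodup.getElem_inj_iff hnd).1 hij)
  refine ⟨Equiv.ofBijective w (Finite.injective_iff_bijective.1 hw), ?_⟩
  rw [pathSum_eq_sum] at h0
  rw [← h0]
  have hlen' : m + 3 = (l ++ [u]).length := by simp [hlen]
  refine Fintype.sum_equiv (finCongr hlen') _ _ fun i => ?_
  simp only [Equiv.ofBijective_apply, finCongr_apply, Fin.val_cast]
  congr 1
  · exact (List.getElem_append_left (as := u :: l) (bs := [u])
      (by simp only [List.length_cons]; omega)).symm
  · by_cases hi : i.val + 1 < m + 3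
    · have : (i + 1).val = i.val + 1 := by
        rw [Fin.val_add_one_of_lt']; exact hi
      simp only [w, this, List.getElem_cons_succ]
      rw [List.getElem_append_left]
    · have hi' : i.val = l.length := by omega
      have : i + 1 = 0 := by
        have : i = Fin.last _ := Fin.ext (by simp; omega)
        rw [this]; exact Fin.last_add_one _
      simp only [w, this, Fin.val_zero, List.getElem_cons_zero]
      simp [hi']

/-- A colouring with few colours has a Hamilton cycle meeting each colour evenly. -/
theorem exists_even_hamilton {m r : ℕ} (hr : 1 ≤ r) (col : Fin (m + 3) → Fin (m + 3) → Fin r)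
    (hcol : ∀ x y, col x y = col y x) (heven : Even (m + 3))
    (hm : 2 * (r * r) + 7 * r + 2 ≤ m + 3) :
    ∃ v : Equiv.Perm (Fin (m + 3)), ∀ k,
      Even (Finset.univ.filter fun i => col (v i) (v (i + 1)) = k).card := by
  let X := Fin r → ZMod 2
  let e : Fin r → X := fun k => Pi.single k 1
  let c : Fin (m + 3) → Fin (m + 3) → X := fun x y => e (col x y)
  have hc : ∀ x y, c x y = c y x := fun x y => by simp only [c, hcol x y]
  have hX : Module.finrank (ZMod 2) X = r := by simp [X]
  have hrr : 1 ≤ r * r := Nat.mul_pos hr hr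
  -- Absorption may use `3 * r` vertices. The remaining `r * r + r + 2` cover both the pigeonhole,
  -- needing `r * r + 2`, and the cycle, needing `r + 2`.
  obtain ⟨gs, R, hcore, hR⟩ := exists_core c (r * r + r + 2 + 3 * r) r Finset.univ ⊤
    (fun _ _ _ => Submodule.mem_top) (by rw [finrank_top, hX])
    (by rw [Finset.card_univ, Fintype.card_fin]; omega)
  obtain ⟨κ, f, htemp⟩ := hcore.exists_template hc (by omega)
  obtain ⟨f, gs, A, R, h, hall, hR⟩ := IsTemplate.exists_full hc col e (fun _ _ => rfl) κ
    (M := r * r + r + 2) (by rw [Fintype.card_fin]; omega) _ f gs R R htemp le_rfl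
    (by rw [hX]; omega)
  have hgs : gs.length ≤ r := by
    have h1 := h.length_le
    have h2 := Submodule.finrank_le (gadgetSpan c gs)
    rw [hX] at h2
    omega
  obtain ⟨u, l, hnd, hl, hsum⟩ := h.exists_even_cycle hc hall (by omega) (by simpa using heven)
  obtain ⟨v, hv⟩ := exists_perm_sum_eq_zero c u l hnd hl hsum
  refine ⟨v, fun k => ?_⟩
  have := congrFun hv k
  rw [Finset.sum_apply] at this
  rw [← ZMod.natCast_eq_zero_iff_even, Finset.card_filter]
  push_cast
  refine (Finset.sum_congr rfl fun i _ => ?_).trans this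
  simp only [c, e, Pi.single_apply, eq_comm]

/-! ### The upper bound -/

/-- A cyclic colouring in which `s` sends distinguishable colours and all other colours come from
an `𝔽₂`-potential has an odd class along every Hamilton cycle. -/
theorem exists_odd_of_potential {V K F : Type*} [DecidableEq K] [Fintype K] [AddCommGroup F]
    [Module (ZMod 2) F] {m : ℕ} (col : V → V → K) (hcol : ∀ x y, col x y = col y x)
    (φ : K → F) (f : V → F) (s : V) (hs : f s = 0)
    (hφ : ∀ x y, x ≠ s → y ≠ s → x ≠ y → φ (col x y) = f x + f y)
    (hφs : ∀ x, x ≠ s → φ (col s x) = 0)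
    (hinj : ∀ x y, x ≠ s → y ≠ s → f x = f y → col s x = col s y → x = y)
    (hrow : ∀ x y, x ≠ s → y ≠ s → col s x ≠ col s y → ∃ z, (z = x ∨ z = y) ∧
      ∀ p q, p ≠ s → q ≠ s → p ≠ q → col p q ≠ col s z)
    (v : Fin (m + 3) → V) (hv : Function.Bijective v) :
    ∃ k, Odd (Finset.univ.filter fun i => col (v i) (v (i + 1)) = k).card := by
  by_contra! hcon
  simp only [Nat.not_odd_iff_even] at hcon
  obtain ⟨j, hj⟩ := hv.2 s
  have hne : ∀ i, v i ≠ v (i + 1) := fun i h => fin_ne_succ i (hv.1 h)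
  have hvs : ∀ i, v i = s ↔ i = j := fun i => ⟨fun h => hv.1 (h.trans hj.symm), fun h => h ▸ hj⟩
  set x := v (j + 1) with hx
  set y := v (j - 1) with hy
  have hxs : x ≠ s := by rw [← hj]; exact (hne j).symm
  have hj1 : j - 1 + 1 = j := by abel
  have hys : y ≠ s := by
    have := hne (j - 1)
    rwa [hj1, hj] at this
  have hjj : j - 1 ≠ j := by
    have := fin_ne_succ (j - 1)
    rwa [hj1] at this
  have hxy : x ≠ y := by
    intro h
    have h := hv.1 h
    have : (1 + 1 : Fin (m + 3)) = 0 := by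
      have h2 : j + 1 - (j - 1) = 0 := by rw [h]; abel
      rw [← h2]; abel
    exact fin_two_ne_zero this
  have hcoly : col (v (j - 1)) (v (j - 1 + 1)) = col s y := by rw [hj1, hj, hcol]
  have hsum : ∑ i, φ (col (v i) (v (i + 1))) = 0 := by
    rw [← Finset.sum_fiberwise Finset.univ (fun i => col (v i) (v (i + 1)))]
    refine Finset.sum_eq_zero fun k _ => ?_
    rw [Finset.sum_congr rfl (g := fun _ => φ k) (by
      intro i hi; rw [(Finset.mem_filter.1 hi).2]), Finset.sum_const]
    obtain ⟨t, ht⟩ := hcon k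
    rw [ht, add_smul, ← two_smul ℕ, ← Nat.cast_smul_eq_nsmul (ZMod 2)]
    have : ((2 : ℕ) : ZMod 2) = 0 := by decide
    rw [this, zero_smul]
  have htot : ∑ i, (f (v i) + f (v (i + 1))) = 0 := by
    have hshift : ∑ i, f (v (i + 1)) = ∑ i, f (v i) :=
      Equiv.sum_comp (Equiv.addRight (1 : Fin (m + 3))) (fun i => f (v i))
    rw [Finset.sum_add_distrib, hshift, ← two_smul ℕ, ← Nat.cast_smul_eq_nsmul (ZMod 2)]
    have : ((2 : ℕ) : ZMod 2) = 0 := by decide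
    rw [this, zero_smul]
  have hself : ∀ a : F, a + a = 0 := fun a => by
    rw [← two_smul ℕ, ← Nat.cast_smul_eq_nsmul (ZMod 2)]
    have : ((2 : ℕ) : ZMod 2) = 0 := by decide
    rw [this, zero_smul]
  -- Edges off `s` contribute zero, so only the two edges at `s` remain.
  have hdiff : ∑ i, (φ (col (v i) (v (i + 1))) + (f (v i) + f (v (i + 1)))) = f x + f y := by
    rw [← Finset.sum_subset (Finset.subset_univ {j, j - 1}), Finset.sum_pair hjj.symm]
    · rw [hcoly, hj1, hj, ← hx, ← hy, hφs x hxs, hφs y hys, hs]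
      abel
    · intro i _ hi
      simp only [Finset.mem_insert, Finset.mem_singleton, not_or] at hi
      have h1 : v i ≠ s := fun h => hi.1 ((hvs i).1 h)
      have h2 : v (i + 1) ≠ s := fun h => hi.2 (by rw [← (hvs _).1 h]; abel)
      rw [hφ _ _ h1 h2 (hne i)]
      exact hself _
  rw [Finset.sum_add_distrib, hsum, htot, add_zero] at hdiff
  have hfxy : f x = f y := by
    have := congrArg (· + f y) hdiff
    simp only [zero_add, add_assoc, hself, add_zero] at this
    exact this.symm
  by_cases hc : col s x = col s y
  · exact hxy (hinj x y hxs hys hfxy hc)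
  obtain ⟨z, hz, hzcol⟩ := hrow x y hxs hys hc
  have hone : ∃ i₀, (Finset.univ.filter fun i => col (v i) (v (i + 1)) = col s z) = {i₀} := by
    have hcases : ∀ i, col (v i) (v (i + 1)) = col s z → i = j ∨ i = j - 1 := by
      intro i hi
      by_contra! hij
      have h1 : v i ≠ s := fun h => hij.1 ((hvs i).1 h)
      have h2 : v (i + 1) ≠ s := fun h => hij.2 (by rw [← (hvs _).1 h]; abel)
      exact hzcol _ _ h1 h2 (hne i) hi
    rcases hz with rfl | rfl
    · refine ⟨j, ?_⟩
      ext i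
      simp only [Finset.mem_filter, Finset.mem_univ, true_and, Finset.mem_singleton]
      constructor
      · intro hi
        rcases hcases i hi with h | h
        · exact h
        · subst h
          rw [hcoly] at hi
          exact absurd hi.symm hc
      · rintro rfl
        rw [hj]
    · refine ⟨j - 1, ?_⟩
      ext i
      simp only [Finset.mem_filter, Finset.mem_univ, true_and, Finset.mem_singleton]
      constructor
      · intro hi
        rcases hcases i hi with h | h
        · subst h
          rw [hj] at hi
          exact absurd hi hc
        · exact h
      · rintro rfl
        exact hcoly
  obtain ⟨i₀, hi₀⟩ := hone
  have := hcon (col s z)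
  rw [hi₀, Finset.card_singleton] at this
  exact absurd this (by decide)

theorem oddRamseyHamilton_le_of_colouring {m : ℕ} {K : Type*} [Fintype K] [Inhabited K]
    [DecidableEq K] (c : (⊤ : SimpleGraph (Fin (m + 3))).edgeSet → K)
    (hc : ∀ v : Equiv.Perm (Fin (m + 3)), ∃ k : K,
        Odd (Finset.univ.filter fun i => pairColour c (v i) (v (i + 1)) = k).card) :
    oddRamseyHamilton (m + 3) ≤ Fintype.card K := by
  refine Nat.sInf_le ⟨fun e => Fintype.equivFin K (c e), ?_⟩
  intro H' hH'
  obtain ⟨k, hk⟩ := (isOddColouring_cycleGraph_iff c).2 hc H' hH'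
  refine ⟨Fintype.equivFin K k, ?_⟩
  simpa only [EmbeddingLike.apply_eq_iff_eq] using hk

/-- Vertex `0` plays the role of `s`; any other `x` has column `(x - 1) % q` and row `(x - 1) / q`.
-/
theorem oddRamseyHamilton_le_two_pow_add (m d : ℕ) :
    oddRamseyHamilton (m + 3) ≤ 2 ^ d + (m + 1) / 2 ^ d := by
  classical
  set q := 2 ^ d with hq
  have hqpos : 0 < q := Nat.two_pow_pos d
  let F := Fin d → ZMod 2
  let K := F ⊕ Fin ((m + 1) / q)
  have hcardF : Fintype.card F = q := by simp [F, hq]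
  let E : Fin q ≃ F := (Fintype.equivFinOfCardEq hcardF).symm
  let f : Fin (m + 3) → F := fun x => if x = 0 then 0 else E ⟨(x.val - 1) % q, Nat.mod_lt _ hqpos⟩
  have hrowlt : ∀ x : Fin (m + 3), (x.val - 1) / q - 1 < (m + 1) / q ∨ (x.val - 1) / q = 0 := by
    intro x
    have : (x.val - 1) / q ≤ (m + 1) / q := Nat.div_le_div_right (by omega)
    generalize (x.val - 1) / q = t at this ⊢
    generalize (m + 1) / q = k at this ⊢
    omega
  -- Row zero reuses the colour `inl 0`, so only `(m + 1) / q` new colours are needed. Of two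
  -- different rows at least one is nonzero, and its colour occurs only at vertex `0`.
  let star : Fin (m + 3) → K := fun x =>
    if h : (x.val - 1) / q = 0 then Sum.inl 0
    else Sum.inr ⟨(x.val - 1) / q - 1, (hrowlt x).resolve_right h⟩
  have hstar : ∀ x y, star x = star y → (x.val - 1) / q = (y.val - 1) / q := by
    intro x y h
    simp only [star] at h
    split_ifs at h with h1 h2 h2
    · rw [h1, h2]
    · have h := congrArg Fin.val (Sum.inr.inj h)
      exact Nat.sub_one_cancel (Nat.pos_of_ne_zero h1) (Nat.pos_of_ne_zero h2) h
  let col : Fin (m + 3) → Fin (m + 3) → K := fun x y =>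
    if x = 0 then star y else if y = 0 then star x else Sum.inl (f x + f y)
  have hcol : ∀ x y, col x y = col y x := by
    intro x y
    simp only [col]
    split_ifs with h1 h2
    · rw [h1, h2]
    · rfl
    · rfl
    · exact congrArg Sum.inl (add_comm _ _)
  let φ : K → F := Sum.elim id fun _ => 0
  have : Inhabited K := ⟨Sum.inl 0⟩
  let c : (⊤ : SimpleGraph (Fin (m + 3))).edgeSet → K := fun e => Sym2.lift ⟨col, hcol⟩ e.1
  have hpair : ∀ x y, x ≠ y → pairColour c x y = col x y := by
    intro x y h
    rw [pairColour_of_ne c h (by simpa using h)]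
    rfl
  have hcard : Fintype.card K = q + (m + 1) / q := by
    simp only [K, Fintype.card_sum, hcardF, Fintype.card_fin]
  rw [← hcard]
  refine oddRamseyHamilton_le_of_colouring c fun v => ?_
  have hne : ∀ i, v i ≠ v (i + 1) := fun i h => fin_ne_succ i (v.injective h)
  simp only [hpair _ _ (hne _)]
  have hcol0 : ∀ x, col 0 x = star x := fun x => if_pos rfl
  have hcolne : ∀ x y, x ≠ 0 → y ≠ 0 → col x y = Sum.inl (f x + f y) := by
    intro x y hx hy
    simp only [col, if_neg hx, if_neg hy]
  refine exists_odd_of_potential col hcol φ f 0 (if_pos rfl) ?_ ?_ ?_ ?_ v v.bijective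
  · intro x y hx hy _
    rw [hcolne x y hx hy]
    rfl
  · intro x _
    rw [hcol0]
    simp only [star]
    split_ifs <;> rfl
  · intro x y hx hy hf h
    rw [hcol0, hcol0] at h
    have h1 := hstar x y h
    simp only [f, if_neg hx, if_neg hy, EmbeddingLike.apply_eq_iff_eq, Fin.mk.injEq] at hf
    have h2 := Nat.div_add_mod (x.val - 1) q
    have h3 := Nat.div_add_mod (y.val - 1) q
    rw [h1, hf, h3] at h2
    have h4 : x.val ≠ 0 := fun h => hx (Fin.ext h)
    have h5 : y.val ≠ 0 := fun h => hy (Fin.ext h)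
    exact Fin.ext (by omega)
  · intro x y hx hy h
    rw [hcol0, hcol0] at h
    have : ∃ z, (z = x ∨ z = y) ∧ (z.val - 1) / q ≠ 0 := by
      by_contra! hcon
      apply h
      have h1 := hcon x (Or.inl rfl)
      have h2 := hcon y (Or.inr rfl)
      simp only [star, dif_pos h1, dif_pos h2]
    obtain ⟨z, hz, hz0⟩ := this
    refine ⟨z, hz, fun p r hp hr _ heq => ?_⟩
    rw [hcolne p r hp hr, hcol0] at heq
    simp only [star, dif_neg hz0] at heq
    exact absurd heq (by simp)

/-! ### Square-root bounds and the final asymptotics. -/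

theorem oddRamseyHamilton_le_sqrt {n : ℕ} (hn : 4 ≤ n) :
    (oddRamseyHamilton n : ℝ) ≤ 3 * √2 / 2 * √(n : ℝ) := by
  obtain ⟨m, rfl⟩ : ∃ m, n = m + 3 := ⟨n - 3, by omega⟩
  -- This choice puts `q = 2 ^ d` between `a` and `2 * a`, where `a = √(n / 2)`.
  set d := Nat.log 4 (2 * (m + 3)) with hd
  have h1 : 4 ^ d ≤ 2 * (m + 3) := Nat.pow_log_le_self 4 (by omega)
  have h2 : 2 * (m + 3) < 4 ^ (d + 1) := Nat.lt_pow_succ_log_self (by norm_num) _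
  have hle := oddRamseyHamilton_le_two_pow_add m d
  set q : ℝ := (2 : ℝ) ^ d with hq
  have hqpos : 0 < q := by positivity
  have hq2 : q ^ 2 = (4 : ℝ) ^ d := by
    rw [hq, ← pow_mul, mul_comm, pow_mul]; norm_num
  have h1' : q ^ 2 ≤ 2 * (m + 3 : ℝ) := by rw [hq2]; exact_mod_cast h1
  have h2' : 2 * (m + 3 : ℝ) ≤ 4 * q ^ 2 := by
    rw [hq2, ← pow_succ']; exact_mod_cast h2.le
  have hle' : (oddRamseyHamilton (m + 3) : ℝ) ≤ q + (m + 3) / q := by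
    have hdiv : (((m + 1) / 2 ^ d : ℕ) : ℝ) ≤ ((m + 1 : ℕ) : ℝ) / ((2 ^ d : ℕ) : ℝ) :=
      Nat.cast_div_le
    have : (oddRamseyHamilton (m + 3) : ℝ) ≤ ((2 ^ d + (m + 1) / 2 ^ d : ℕ) : ℝ) := by
      exact_mod_cast hle
    refine this.trans ?_
    push_cast at hdiv ⊢
    have h3 : ((m : ℝ) + 1) / 2 ^ d ≤ (m + 3) / q := by
      rw [hq]; gcongr; norm_num
    linarith
  refine hle'.trans ?_
  set a : ℝ := √2 / 2 * √((m + 3 : ℕ) : ℝ) with ha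
  have ha0 : 0 ≤ a := by positivity
  have ha2 : a ^ 2 = (m + 3 : ℝ) / 2 := by
    rw [ha, mul_pow, div_pow, Real.sq_sqrt (by norm_num), Real.sq_sqrt (by positivity)]
    push_cast
    ring
  have haq : a ≤ q := by
    apply le_of_sq_le_sq _ hqpos.le
    linarith
  have hqa : q ≤ 2 * a := by
    apply le_of_sq_le_sq _ (by positivity)
    rw [mul_pow]
    linarith
  have : 3 * √2 / 2 * √((m + 3 : ℕ) : ℝ) = 3 * a := by rw [ha]; ring
  rw [this, ← sub_nonneg]
  -- The convex function `q + 2 * a ^ 2 / q` equals `3 * a` at both ends of `[a, 2 * a]`.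
  have heq : 3 * a - (q + (m + 3) / q) = (q - a) * (2 * a - q) / q := by
    field_simp
    linear_combination 2 * ha2
  rw [heq]
  exact div_nonneg (mul_nonneg (by linarith) (by linarith)) hqpos.le

theorem lt_of_oddRamseyHamilton {n : ℕ} (heven : Even n) (hn : 4 ≤ n) :
    n < 2 * (oddRamseyHamilton n + 5) ^ 2 := by
  classical
  obtain ⟨m, rfl⟩ : ∃ m, n = m + 3 := ⟨n - 3, by omega⟩
  have hadj : ∃ x y, (SimpleGraph.cycleGraph (m + 3)).Adj x y := ⟨0, _, cycleGraph_adj_succ 0⟩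
  obtain ⟨c, hc⟩ : ∃ c : (⊤ : SimpleGraph (Fin (m + 3))).edgeSet →
      Fin (oddRamseyHamilton (m + 3)), IsOddColouring (SimpleGraph.cycleGraph (m + 3)) c :=
    (oddRamseyNumber_spec (⊤ : SimpleGraph (Fin (m + 3))) _ hadj).1
  by_contra! hcon
  have hr : 1 ≤ oddRamseyHamilton (m + 3) :=
    Nat.succ_le_of_lt (Fin.pos (c ⟨s(0, 1), by simp⟩))
  have : Inhabited (Fin (oddRamseyHamilton (m + 3))) := ⟨⟨0, hr⟩⟩
  -- The square `2 * (r + 5) ^ 2` is a convenient majorant of `2 * r ^ 2 + 7 * r + 2`.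
  obtain ⟨v, hv⟩ := exists_even_hamilton hr (pairColour c) (pairColour_comm c) heven
    (le_trans (by ring_nf; omega) hcon)
  obtain ⟨k, hk⟩ := (isOddColouring_cycleGraph_iff c).1 hc v
  exact (Nat.not_odd_iff_even.2 (hv k)) hk

theorem sqrt_le_oddRamseyHamilton {n : ℕ} (heven : Even n) (hn : 4 ≤ n) :
    √2 / 2 * √(n : ℝ) - 5 ≤ (oddRamseyHamilton n : ℝ) := by
  have h : (n : ℝ) ≤ 2 * (oddRamseyHamilton n + 5 : ℝ) ^ 2 := by
    exact_mod_cast (lt_of_oddRamseyHamilton heven hn).le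
  have h2 : √2 / 2 * √(n : ℝ) ≤ oddRamseyHamilton n + 5 := by
    apply le_of_sq_le_sq _ (by positivity)
    rw [mul_pow, div_pow, Real.sq_sqrt (by norm_num), Real.sq_sqrt (by positivity)]
    linarith
  linarith

theorem theorem1p1 :
    (∃ ε : ℕ → ℝ, Tendsto ε atTop (𝓝 0) ∧
      ∀ n : ℕ, Even n → 4 ≤ n →
        (√2 / 2 + ε n) * √(n : ℝ) ≤ (oddRamseyHamilton n : ℝ) ∧
        (oddRamseyHamilton n : ℝ) ≤ 3 * √2 / 2 * √(n : ℝ)) ∧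
    (fun n : ℕ => (oddRamseyHamilton n : ℝ)) =Θ[atTop ⊓ 𝓟 {n : ℕ | Even n}]
      (fun n : ℕ => √(n : ℝ)) := by
  have hsqrt : Tendsto (fun n : ℕ => √(n : ℝ)) atTop atTop :=
    Real.tendsto_sqrt_atTop.comp tendsto_natCast_atTop_atTop
  refine ⟨⟨fun n => -5 / √(n : ℝ), hsqrt.const_div_atTop (-5), fun n heven hn =>
    ⟨?_, oddRamseyHamilton_le_sqrt hn⟩⟩, ?_, ?_⟩
  · have hpos : 0 < √(n : ℝ) := Real.sqrt_pos.2 (by exact_mod_cast (by omega : 0 < n))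
    have heq : (√2 / 2 + -5 / √(n : ℝ)) * √(n : ℝ) = √2 / 2 * √(n : ℝ) - 5 := by
      field_simp
      ring
    rw [heq]
    exact sqrt_le_oddRamseyHamilton heven hn
  · refine IsBigO.of_bound (3 * √2 / 2) ?_
    rw [eventually_inf_principal]
    filter_upwards [eventually_ge_atTop 4] with n hn _
    rw [Real.norm_of_nonneg (by positivity), Real.norm_of_nonneg (by positivity)]
    exact oddRamseyHamilton_le_sqrt hn
  · refine IsBigO.of_bound 5 ?_
    rw [eventually_inf_principal]
    -- With `√2 ≥ 1.4` the claim reduces to `5 * (0.7 * √n - 5) ≥ √n`, which holds once `√n ≥ 10`.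
    filter_upwards [eventually_ge_atTop 4, hsqrt.eventually_ge_atTop 13] with n hn hlarge heven
    rw [Real.norm_of_nonneg (by positivity), Real.norm_of_nonneg (by positivity)]
    have h := sqrt_le_oddRamseyHamilton heven hn
    have h2 : (1.4 : ℝ) ≤ √2 := Real.le_sqrt_of_sq_le (by norm_num)
    nlinarith [mul_nonneg (sub_nonneg.2 h2) (sub_nonneg.2 hlarge)]
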